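/- **Theorem 3.5 (Kalman Observability Rank Condition).** Let $\mathbb{T}\subseteq\mathbb{R}$ be a time scale (a nonempty closed set) that is unbounded above and has bounded graininess $\mu(t)=\sigma(t)-t$, where $\sigma(t)=\inf\{s\in\mathbb{T}: s>t\}$. Let $A\in\mathbb{R}^{n\times n}$, $C\in\mathbb{R}^{p\times n}$, and suppose that $A$ is regressive, i.e. $I+\mu(t)A$ is invertible for every $t\in\mathbb{T}$. Let $t_0<t_f$ be points of $\mathbb{T}$, and write $[t_0,t_f)_{\mathbb{T}}=[t_0,t_f)\cap\mathbb{T}$. The system $$x^\Delta(t)=Ax(t),\quad x(t_0)=x_0,\qquad y(t)=Cx(t)$$ ($x^\Delta$ the delta derivative, $t\in\mathbb{T}$) is called observable on $[t_0,t_f]$ if every initial state $x_0$ is uniquely determined by the response $y(t)$, $t\in[t_0,t_f)_{\mathbb{T}}$. Let $$\mathcal{O}=\begin{bmatrix}C\\ CA\\ \vdots\\ CA^{n-1}\end{bmatrix}\in\mathbb{R}^{np\times n}$$ be the observability matrix. 1. If the system is observable on $[t_0,t_f]$, then $\operatorname{rank}\mathcal{O}=n$. 2. If $[t_0,t_f)_{\mathbb{T}}$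 contains at least $n$ points (in particular, if it is infinite), then the system is observable on $[t_0,t_f]$ if and only if $\operatorname{rank}\mathcal{O}=n$. 3. The transition matrix $\Phi_A(\cdot,t_0)$, i.e. a solution on $\mathbb{T}$ of $X^\Delta=AX$, $X(t_0)=I$, exists. If the observability Gramian $$\mathscr{G}_O(t_0,t_f)=\int_{t_0}^{t_f}\Phi_A^T(t,t_0)\,C^TC\,\Phi_A(t,t_0)\,\Delta t$$ formed with any such solution is invertible, then $\operatorname{rank}\mathcal{O}=n$; and if $[t_0,t_f)_{\mathbb{T}}$ contains at least $n$ points, then $\operatorname{rank}\mathcal{O}=n$ if and only if $\mathscr{G}_O(t_0,t_f)$ is invertible. -/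

import Mathlib

open MeasureTheory

noncomputable section

/-- The forward jump operator `σ t = inf {s ∈ T | t < s}` of `T` (the infimum is over a nonempty
set when `T` is unbounded above). -/
def forwardJump (T : Set ℝ) (t : ℝ) : ℝ := sInf {s | s ∈ T ∧ t < s}

/-- The graininess `μ t = σ t - t`. -/
def graininess (T : Set ℝ) (t : ℝ) : ℝ := forwardJump T t - t

/-- A time scale (nonempty closed subset of `ℝ`) that is unbounded above and has bounded
graininess. Since `T` is unbounded above, `T^κ = T`. -/
structure IsUnboundedTimeScale (T : Set ℝ) : Prop where
  nonempty : T.Nonempty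
  isClosed : IsClosed T
  not_bddAbove : ¬ BddAbove T
  bounded_graininess : ∃ M : ℝ, ∀ t ∈ T, graininess T t ≤ M

/-- `f` has (Hilger) delta derivative `f'` at the point `t` of the time scale `T`.
Only the values of `f` on `T` matter. -/
def HasDeltaDerivAt {E : Type*} [NormedAddCommGroup E] [NormedSpace ℝ E]
    (T : Set ℝ) (f : ℝ → E) (f' : E) (t : ℝ) : Prop :=
  ∀ ε : ℝ, 0 < ε → ∃ δ : ℝ, 0 < δ ∧ ∀ s ∈ T, |s - t| < δ →
    ‖f (forwardJump T t) - f s - (forwardJump T t - s) • f'‖ ≤ ε * |forwardJump T t - s|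

/-- The constant matrix `A` is regressive on `T`: `I + μ(t) A` is invertible for all `t ∈ T`. -/
def IsRegressive {n : ℕ} (T : Set ℝ) (A : Matrix (Fin n) (Fin n) ℝ) : Prop :=
  ∀ t ∈ T, IsUnit (1 + graininess T t • A)

/-- `x` solves `x^Δ(t) = A x(t)` on `T`. -/
def IsSolution {n : ℕ} (T : Set ℝ) (A : Matrix (Fin n) (Fin n) ℝ)
    (x : ℝ → Fin n → ℝ) : Prop :=
  ∀ t ∈ T, HasDeltaDerivAt T x (A.mulVec (x t)) t

/-- The system `x^Δ = A x`, `y = C x` is observable on `[t₀, t_f]`: the initial state `x(t₀)` is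
uniquely determined by the response `y(t) = C x(t)`, `t ∈ [t₀, t_f)`, `t ∈ T`. -/
def IsObservable {n p : ℕ} (T : Set ℝ) (A : Matrix (Fin n) (Fin n) ℝ)
    (C : Matrix (Fin p) (Fin n) ℝ) (t₀ tf : ℝ) : Prop :=
  ∀ x₁ x₂ : ℝ → Fin n → ℝ, IsSolution T A x₁ → IsSolution T A x₂ →
    (∀ t ∈ T ∩ Set.Ico t₀ tf, C.mulVec (x₁ t) = C.mulVec (x₂ t)) → x₁ t₀ = x₂ t₀

/-- The block column matrix with blocks `C`, `C A`, …, `C A ^ (n - 1)`; row `(k, i)` is row `i`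
of the block `C A ^ k`. -/
def observabilityMatrix {n p : ℕ} (A : Matrix (Fin n) (Fin n) ℝ)
    (C : Matrix (Fin p) (Fin n) ℝ) : Matrix (Fin n × Fin p) (Fin n) ℝ :=
  Matrix.of fun r j => (C * A ^ (r.1 : ℕ)) r.2 j

/-- `Φ` is the transition matrix `t ↦ Φ_A(t, t₀)`: the solution of `X^Δ = A X`, `X(t₀) = I`,
on `T` (entrywise derivatives). -/
def IsTransitionMatrix {n : ℕ} (T : Set ℝ) (A : Matrix (Fin n) (Fin n) ℝ) (t₀ : ℝ)
    (Φ : ℝ → Matrix (Fin n) (Fin n) ℝ) : Prop :=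
  Φ t₀ = 1 ∧
    ∀ t ∈ T, ∀ i j, HasDeltaDerivAt T (fun s => Φ s i j) ((A * Φ t) i j) t

/-- The Lebesgue delta measure of `T`: Lebesgue measure on `T`, plus an atom of mass `μ(t)` at
every right-scattered point `t` of `T` (so `[a, b) ∩ T` has measure `b - a` for `a ≤ b` in `T`). -/
def deltaMeasure (T : Set ℝ) : Measure ℝ :=
  volume.restrict T +
    Measure.sum fun t : {t : ℝ // t ∈ T ∧ t < forwardJump T t} =>
      ENNReal.ofReal (graininess T t) • Measure.dirac (t : ℝ)

/-- The observability Gramian `∫_{t₀}^{t_f} Φᵀ(t) Cᵀ C Φ(t) Δt` (entrywise delta integral,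
taken over `[t₀, t_f) ∩ T`). -/
def observabilityGramian {n p : ℕ} (T : Set ℝ) (C : Matrix (Fin p) (Fin n) ℝ)
    (Φ : ℝ → Matrix (Fin n) (Fin n) ℝ) (t₀ tf : ℝ) : Matrix (Fin n) (Fin n) ℝ :=
  Matrix.of fun i j =>
    ∫ t in T ∩ Set.Ico t₀ tf, ((Φ t).transpose * C.transpose * C * Φ t) i j ∂(deltaMeasure T)

end

/-! Every assertion compares kernels. The kernel of the observability matrix is the set of `v` with
`C A ^ k v = 0` for `k < n`, hence for all `k` by Cayley–Hamilton. From `t₀` onwards the solution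
starting at `v` is `∑ h_k(t, t₀) A ^ k v`, with `h_k` the time scale monomials, so such a `v`
produces zero output (`IsSolution.output_eq_zero`).

Conversely, zero output on at least `n` points forces `C A ^ k x(t₀) = 0` for `k < n`
(`IsSolution.mulVec_pow_eq_zero_of_output_eq_zero`). At a right-scattered point the jump formula
`x(σ t) = x(t) + μ(t) A x(t)` trades one sample for one more power of `A`; at a right-dense point
the zero output can be differentiated arbitrarily often.

The Gramian satisfies `vᵀ G v = ∫ |C Φ v|² Δt`, and nonempty relatively open pieces of `[t₀, t_f) ∩
T` have positive delta measure, so its kernel is exactly the set of initial states with zero output.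

Since solutions live on all of `T`, a solution through each initial state must also be continued to
the left of `t₀`. This is where regressivity enters: it makes the exponential invertible
(`isUnit_timeExp`). -/

open Filter Topology Asymptotics

/-! ### Forward jumps and induction on time scales. -/

section ForwardJump

variable {T : Set ℝ} {t s : ℝ}

theorem forwardJump_le (hs : s ∈ T) (h : t < s) : forwardJump T t ≤ s :=
  csInf_le ⟨t, fun _ hr => hr.2.le⟩ ⟨hs, h⟩

theorem exists_mem_gt_of_not_bddAbove (hu : ¬ BddAbove T) (t : ℝ) : ∃ s ∈ T, t < s := by
  rw [not_bddAbove_iff] at hu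
  exact hu t

theorem le_forwardJump (hu : ¬ BddAbove T) (t : ℝ) : t ≤ forwardJump T t := by
  obtain ⟨s, hs, hts⟩ := exists_mem_gt_of_not_bddAbove hu t
  exact le_csInf ⟨s, hs, hts⟩ fun _ hr => hr.2.le

theorem forwardJump_mem (hc : IsClosed T) (hu : ¬ BddAbove T) (t : ℝ) : forwardJump T t ∈ T := by
  obtain ⟨s, hs, hts⟩ := exists_mem_gt_of_not_bddAbove hu t
  have h := csInf_mem_closure (s := {s | s ∈ T ∧ t < s}) ⟨s, hs, hts⟩ ⟨t, fun _ hr => hr.2.le⟩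
  exact hc.closure_subset_iff.2 (fun r hr => hr.1) h

theorem exists_mem_Ioo_of_forwardJump_eq (hu : ¬ BddAbove T) (h : forwardJump T t = t)
    {r : ℝ} (hr : t < r) : ∃ s ∈ T, t < s ∧ s < r := by
  obtain ⟨s, hs, hts⟩ := exists_mem_gt_of_not_bddAbove hu t
  obtain ⟨q, hq, hqr⟩ := exists_lt_of_csInf_lt (s := {s | s ∈ T ∧ t < s}) ⟨s, hs, hts⟩
    (show sInf {s | s ∈ T ∧ t < s} < r from lt_of_eq_of_lt h hr)
  exact ⟨q, hq.1, hq.2, hqr⟩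

/-- Truncating at a point of `T` supplies the least element that induction and the exponential
require; jumps look only to the right, so nothing changes. -/
theorem forwardJump_inter_Ici {a : ℝ} (h : a ≤ t) :
    forwardJump (T ∩ Set.Ici a) t = forwardJump T t := by
  unfold forwardJump
  congr 1
  ext s
  simp only [Set.mem_ofPred_eq, Set.mem_inter_iff, Set.mem_Ici]
  exact ⟨fun h => ⟨h.1.1, h.2⟩, fun h' => ⟨⟨h'.1, h.trans h'.2.le⟩, h'.2⟩⟩

theorem not_bddAbove_inter_Ici (hu : ¬ BddAbove T) (a : ℝ) : ¬ BddAbove (T ∩ Set.Ici a) := by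
  rw [not_bddAbove_iff] at hu ⊢
  intro x
  obtain ⟨s, hs, h⟩ := hu (max x a)
  exact ⟨s, ⟨hs, (le_max_right x a).trans h.le⟩, (le_max_left x a).trans_lt h⟩

/-- Induction along a closed set that is unbounded above and has a least element. -/
theorem timeScale_induction {a : ℝ} (hc : IsClosed T) (hu : ¬ BddAbove T) (ha : IsLeast T a)
    {P : ℝ → Prop} (base : P a)
    (scattered : ∀ t ∈ T, t < forwardJump T t → P t → P (forwardJump T t))
    (dense : ∀ t ∈ T, forwardJump T t = t → P t → ∃ δ > 0, ∀ s ∈ T, t < s → s < t + δ → P s)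
    (left : ∀ t ∈ T, (∀ δ > 0, ∃ s ∈ T, t - δ < s ∧ s < t) → (∀ s ∈ T, s < t → P s) → P t) :
    ∀ t ∈ T, P t := by
  by_contra! hbad
  obtain ⟨b, hb, hPb⟩ := hbad
  set S : Set ℝ := {s | s ∈ T ∧ ¬ P s} with hS
  have hSne : S.Nonempty := ⟨b, hb, hPb⟩
  have hSbd : BddBelow S := ⟨a, fun s hs => ha.2 hs.1⟩
  set c := sInf S with hcdef
  have hcT : c ∈ T := hc.closure_subset_iff.2 (fun r hr => hr.1) (csInf_mem_closure hSne hSbd)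
  have hlt : ∀ s ∈ T, s < c → P s := by
    intro s hs hsc
    by_contra hP
    exact absurd (csInf_le hSbd (show s ∈ S from ⟨hs, hP⟩)) (not_le.2 hsc)
  have hPc : P c := by
    by_cases hd : ∀ δ > 0, ∃ s ∈ T, c - δ < s ∧ s < c
    · exact left c hcT hd hlt
    push Not at hd
    obtain ⟨δ, hδ, hd⟩ := hd
    rcases eq_or_lt_of_le (ha.2 hcT) with h | h
    · rwa [← h]
    -- With a gap to the left of `c`, the last point `r` of `T` before the gap jumps exactly to `c`.
    have hne : (T ∩ Set.Iic (c - δ)).Nonempty := by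
      refine ⟨a, ha.1, ?_⟩
      by_contra h'
      exact absurd (hd a ha.1 (not_le.1 h')) (not_le.2 h)
    have hbd : BddAbove (T ∩ Set.Iic (c - δ)) := ⟨c - δ, fun _ h => h.2⟩
    have hr := (hc.inter isClosed_Iic).csSup_mem hne hbd
    set r := sSup (T ∩ Set.Iic (c - δ)) with hrdef
    have hrc : r < c := lt_of_le_of_lt hr.2 (by linarith)
    have hj : forwardJump T r = c := by
      apply le_antisymm (forwardJump_le hcT hrc)
      refine le_csInf ⟨c, hcT, hrc⟩ ?_
      rintro s ⟨hs, hrs⟩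
      by_contra! hsc
      have : s ≤ c - δ := by
        by_contra! h'
        exact absurd (hd s hs h') (not_le.2 hsc)
      exact absurd (le_csSup hbd ⟨hs, this⟩) (not_le.2 hrs)
    rw [← hj]
    exact scattered r hr.1 (hj ▸ hrc) (hlt r hr.1 hrc)
  -- As `P c` holds, the infimum `c` is not attained, so bad points accumulate at `c` from the
  -- right.
  have hgt : ∀ d, c < d → ∃ s ∈ S, c < s ∧ s < d := by
    intro d hd
    obtain ⟨s, hs, hsd⟩ := exists_lt_of_csInf_lt hSne hd
    refine ⟨s, hs, lt_of_le_of_ne (csInf_le hSbd hs) ?_, hsd⟩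
    rintro rfl
    exact hs.2 hPc
  rcases eq_or_lt_of_le (le_forwardJump hu c) with h | h
  · obtain ⟨δ, hδ, hP⟩ := dense c hcT h.symm hPc
    obtain ⟨s, hs, h1, h2⟩ := hgt (c + δ) (by linarith)
    exact hs.2 (hP s hs.1 h1 h2)
  · obtain ⟨s, hs, h1, h2⟩ := hgt _ h
    exact absurd (forwardJump_le hs.1 h1) (not_le.2 h2)

end ForwardJump

/-! ### Calculus of the delta derivative and uniqueness of solutions. -/

section DeltaDeriv

variable {E F : Type*} [NormedAddCommGroup E] [NormedSpace ℝ E] [NormedAddCommGroup F]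
  [NormedSpace ℝ F] {T : Set ℝ} {t : ℝ} {f g : ℝ → E} {f' g' : E}

/-- Gives linearity for free from asymptotics. The comparison function does not tend to `0` when `t`
is right-scattered. -/
theorem hasDeltaDerivAt_iff_isLittleO : HasDeltaDerivAt T f f' t ↔
    (fun s => f (forwardJump T t) - f s - (forwardJump T t - s) • f') =o[𝓝[T] t]
      fun s => forwardJump T t - s := by
  rw [isLittleO_iff]
  unfold HasDeltaDerivAt
  refine forall_congr' fun ε => forall_congr' fun _ => ?_
  rw [eventually_nhdsWithin_iff, Metric.eventually_nhds_iff]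
  simp only [Real.dist_eq, Real.norm_eq_abs, gt_iff_lt]
  exact exists_congr fun δ => and_congr_right fun _ =>
    ⟨fun h s h1 h2 => h s h2 h1, fun h s h1 h2 => h h2 h1⟩

theorem HasDeltaDerivAt.clm_apply (h : HasDeltaDerivAt T f f' t) (L : E →L[ℝ] F) :
    HasDeltaDerivAt T (fun s => L (f s)) (L f') t := by
  rw [hasDeltaDerivAt_iff_isLittleO] at h ⊢
  refine (L.isBigO_comp (fun s => f (forwardJump T t) - f s - (forwardJump T t - s) • f')
    (𝓝[T] t)).trans_isLittleO h |>.congr_left fun s => ?_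
  simp

theorem HasDeltaDerivAt.sub (hf : HasDeltaDerivAt T f f' t) (hg : HasDeltaDerivAt T g g' t) :
    HasDeltaDerivAt T (fun s => f s - g s) (f' - g') t := by
  rw [hasDeltaDerivAt_iff_isLittleO] at *
  refine (IsLittleO.sub hf hg).congr_left fun s => ?_
  rw [smul_sub]
  abel

theorem hasDeltaDerivAt_pi {ι : Type*} [Fintype ι] {G : ι → Type*}
    [∀ i, NormedAddCommGroup (G i)] [∀ i, NormedSpace ℝ (G i)] {f : ℝ → ∀ i, G i} {f' : ∀ i, G i}
    (h : ∀ i, HasDeltaDerivAt T (fun s => f s i) (f' i) t) : HasDeltaDerivAt T f f' t := by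
  simp only [hasDeltaDerivAt_iff_isLittleO] at *
  exact isLittleO_pi.2 h

/-- Taking `s = t` in the definition bounds a fixed vector by `ε * μ(t)` for every `ε`. -/
theorem HasDeltaDerivAt.apply_forwardJump (h : HasDeltaDerivAt T f f' t) (ht : t ∈ T) :
    f (forwardJump T t) = f t + graininess T t • f' := by
  rw [hasDeltaDerivAt_iff_isLittleO] at h
  have h0 : f (forwardJump T t) - f t - (forwardJump T t - t) • f' = 0 := by
    rw [← norm_le_zero_iff]
    refine le_of_forall_pos_le_add fun ε hε => ?_
    have hc : 0 < ε / (|forwardJump T t - t| + 1) := by positivity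
    have := (h.def hc).self_of_nhdsWithin ht
    refine this.trans ?_
    rw [zero_add, Real.norm_eq_abs, div_mul_eq_mul_div, div_le_iff₀ (by positivity)]
    nlinarith [abs_nonneg (forwardJump T t - t)]
  rw [sub_sub, sub_eq_zero] at h0
  exact h0

theorem HasDeltaDerivAt.continuousWithinAt (h : HasDeltaDerivAt T f f' t) (ht : t ∈ T) :
    ContinuousWithinAt f T t := by
  have hj := h.apply_forwardJump ht
  rw [hasDeltaDerivAt_iff_isLittleO] at h
  rw [Metric.continuousWithinAt_iff']
  intro ε hε
  set m := |forwardJump T t - t| with hm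
  have h1 : ∀ᶠ s in 𝓝[T] t, |s - t| < 1 := eventually_nhdsWithin_of_eventually_nhds <|
    Metric.eventually_nhds_iff.2 ⟨1, one_pos, fun y hy => hy⟩
  have h2 : ∀ᶠ s in 𝓝[T] t, |s - t| < ε / (2 * (‖f'‖ + 1)) :=
    eventually_nhdsWithin_of_eventually_nhds <|
    Metric.eventually_nhds_iff.2 ⟨_, by positivity, fun y hy => hy⟩
  have hc : 0 < ε / (2 * (m + 1)) := by positivity
  filter_upwards [h1, h2, h.def hc] with s h1 h2 h3
  rw [dist_eq_norm]
  have e : f s - f t = -(f (forwardJump T t) - f s - (forwardJump T t - s) • f')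
      + (s - t) • f' := by
    rw [hj, graininess]; module
  rw [e]
  refine (norm_add_le _ _).trans_lt ?_
  rw [norm_neg, norm_smul, Real.norm_eq_abs]
  have e1 : ε / (2 * (m + 1)) * ‖forwardJump T t - s‖ ≤ ε / 2 := by
    rw [div_mul_eq_mul_div, div_le_div_iff₀ (by positivity) two_pos, Real.norm_eq_abs]
    have : |forwardJump T t - s| ≤ m + 1 := by
      have e2 : forwardJump T t - s = (forwardJump T t - t) - (s - t) := by ring
      rw [e2]
      exact (abs_sub _ _).trans (by linarith)
    nlinarith
  have e2 : |s - t| * ‖f'‖ < ε / 2 := by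
    rw [lt_div_iff₀ (by positivity)] at h2
    rcases eq_or_lt_of_le (abs_nonneg (s - t)) with h | h
    · rw [← h]; linarith
    · nlinarith
  linarith

theorem HasDeltaDerivAt.inter_Ici {a : ℝ} (h : HasDeltaDerivAt T f f' t) (hat : a ≤ t) :
    HasDeltaDerivAt (T ∩ Set.Ici a) f f' t := by
  rw [hasDeltaDerivAt_iff_isLittleO] at *
  rw [forwardJump_inter_Ici hat]
  exact h.mono (nhdsWithin_mono _ Set.inter_subset_left)

/-- A delta derivative on `T ∩ [a, ∞)` is one on `T` if no points of `T` below `a` are near `t`. -/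
theorem HasDeltaDerivAt.of_inter_Ici {a : ℝ} (hc : IsClosed T) (hu : ¬ BddAbove T)
    (h : HasDeltaDerivAt (T ∩ Set.Ici a) g f' t) (hat : a ≤ t)
    (hnear : a < t ∨ IsLeast T a) (hfg : ∀ s ∈ T, a ≤ s → f s = g s) :
    HasDeltaDerivAt T f f' t := by
  rw [hasDeltaDerivAt_iff_isLittleO] at *
  rw [forwardJump_inter_Ici hat] at h
  have hge : ∀ᶠ s in 𝓝[T] t, a ≤ s := by
    rcases hnear with h | h
    · exact eventually_nhdsWithin_of_eventually_nhds ((lt_mem_nhds h).mono fun _ => le_of_lt)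
    · filter_upwards [self_mem_nhdsWithin] with s hs using h.2 hs
  have hmem : ∀ᶠ s in 𝓝[T] t, s ∈ T ∩ Set.Ici a := by
    filter_upwards [self_mem_nhdsWithin, hge] with s h1 h2 using ⟨h1, h2⟩
  have hle : 𝓝[T] t ≤ 𝓝[T ∩ Set.Ici a] t := by
    refine le_inf inf_le_left ?_
    rwa [le_principal_iff]
  refine (h.mono hle).congr' ?_ EventuallyEq.rfl
  filter_upwards [hmem] with s hs
  rw [hfg s hs.1 hs.2, hfg _ (forwardJump_mem hc hu t) (hat.trans (le_forwardJump hu t))]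

/-- Uniqueness for linear dynamic equations: a Gronwall argument. -/
theorem eq_zero_of_hasDeltaDerivAt_of_norm_le {a K : ℝ} (hc : IsClosed T) (hu : ¬ BddAbove T)
    (ha : IsLeast T a) (hK : 0 ≤ K) {d : ℝ → E} (hd : ∀ t ∈ T, HasDeltaDerivAt T f (d t) t)
    (hle : ∀ t ∈ T, ‖d t‖ ≤ K * ‖f t‖) (h0 : f a = 0) : ∀ t ∈ T, f t = 0 := by
  -- The rate `K + 1` instead of `K` leaves room, since the exponential is at least `1`, for the
  -- error `ε * (s - t)` of the derivative at right-dense points.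
  have key : ∀ ε > 0, ∀ t ∈ T, ‖f t‖ ≤ ε * Real.exp ((K + 1) * (t - a)) := by
    intro ε hε
    refine timeScale_induction hc hu ha ?_ ?_ ?_ ?_
    · simp [h0, hε.le]
    · intro t ht hlt hP
      rw [(hd t ht).apply_forwardJump ht]
      have hm : 0 ≤ graininess T t := sub_nonneg.2 hlt.le
      have e : (K + 1) * (forwardJump T t - a) = (K + 1) * (t - a) + (K + 1) * graininess T t := by
        unfold graininess; ring
      rw [e, Real.exp_add]
      have h1 := Real.add_one_le_exp ((K + 1) * graininess T t)
      have h2 : ‖f t + graininess T t • d t‖ ≤ ‖f t‖ * (1 + K * graininess T t) := by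
        refine (norm_add_le _ _).trans ?_
        rw [norm_smul, Real.norm_of_nonneg hm]
        nlinarith [hle t ht]
      calc _ ≤ _ := h2
        _ ≤ (ε * Real.exp ((K + 1) * (t - a))) * (1 + K * graininess T t) := by gcongr
        _ ≤ (ε * Real.exp ((K + 1) * (t - a))) * Real.exp ((K + 1) * graininess T t) := by
            gcongr; linarith
        _ = _ := by ring
    · intro t ht hj hP
      obtain ⟨δ, hδ, h⟩ := hd t ht ε hε
      refine ⟨δ, hδ, fun s hs hts hsd => ?_⟩
      have h1 := h s hs (by rw [abs_of_pos (by linarith)]; linarith)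
      rw [hj, abs_of_neg (by linarith : t - s < 0)] at h1
      have e : f s = f t + (s - t) • d t - (f t - f s - (t - s) • d t) := by module
      have h2 : ‖f s‖ ≤ ‖f t‖ + (s - t) * (K * ‖f t‖) + ε * (s - t) := by
        rw [e]
        refine (norm_sub_le _ _).trans (add_le_add ((norm_add_le _ _).trans ?_) (by linarith))
        rw [norm_smul, Real.norm_of_nonneg (by linarith)]
        have := hle t ht
        gcongr
      have e2 : (K + 1) * (s - a) = (K + 1) * (t - a) + (K + 1) * (s - t) := by ring
      rw [e2, Real.exp_add]
      have h3 := Real.add_one_le_exp ((K + 1) * (s - t))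
      have h4 : 1 ≤ Real.exp ((K + 1) * (t - a)) := by
        apply Real.one_le_exp
        have := ha.2 ht
        apply mul_nonneg <;> linarith
      set φ := Real.exp ((K + 1) * (t - a))
      have hst : 0 ≤ s - t := by linarith
      calc _ ≤ _ := h2
        _ = ‖f t‖ * (1 + K * (s - t)) + ε * 1 * (s - t) := by ring
        _ ≤ (ε * φ) * (1 + K * (s - t)) + ε * φ * (s - t) := by gcongr
        _ = (ε * φ) * ((K + 1) * (s - t) + 1) := by ring
        _ ≤ (ε * φ) * Real.exp ((K + 1) * (s - t)) := by gcongr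
        _ = _ := by ring
    · intro t ht hden hP
      have hcw := ((hd t ht).continuousWithinAt ht).norm
      have hcl : t ∈ closure (T ∩ Set.Iio t) := by
        rw [Metric.mem_closure_iff]
        intro δ hδ
        obtain ⟨s, hs, h1, h2⟩ := hden δ hδ
        refine ⟨s, ⟨hs, h2⟩, ?_⟩
        rw [Real.dist_eq, abs_of_pos (by linarith)]
        linarith
      have : (𝓝[T ∩ Set.Iio t] t).NeBot := mem_closure_iff_nhdsWithin_neBot.1 hcl
      refine le_of_tendsto_of_tendsto (b := 𝓝[T ∩ Set.Iio t] t) (hcw.mono Set.inter_subset_left)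
        (g := fun s => ε * Real.exp ((K + 1) * (s - a))) ?_ ?_
      · exact (Continuous.tendsto (by fun_prop) t).mono_left nhdsWithin_le_nhds
      · filter_upwards [self_mem_nhdsWithin] with s hs using hP s hs.1 hs.2
  intro t ht
  rw [← norm_le_zero_iff]
  refine le_of_forall_pos_le_add fun ε hε => ?_
  refine (key (ε / Real.exp ((K + 1) * (t - a))) (by positivity) t ht).trans ?_
  rw [div_mul_cancel₀ _ (Real.exp_pos _).ne', zero_add]

end DeltaDeriv

/-! ### Delta antiderivatives as Lebesgue integrals along the floor map. -/

noncomputable section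

/-- The largest element of `T` that is at most `max s a`. -/
def timeFloor (T : Set ℝ) (a s : ℝ) : ℝ := sSup (T ∩ Set.Iic (max s a))

section Floor

variable {T : Set ℝ} {a s t : ℝ}

theorem timeFloor_mem (hc : IsClosed T) (ha : IsLeast T a) (s : ℝ) :
    timeFloor T a s ∈ T ∩ Set.Iic (max s a) :=
  (hc.inter isClosed_Iic).csSup_mem ⟨a, ha.1, Set.mem_Iic.2 (le_max_right _ _)⟩ ⟨max s a, fun _ h => h.2⟩

theorem le_timeFloor (ht : t ∈ T) (h : t ≤ max s a) : t ≤ timeFloor T a s :=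
  le_csSup ⟨max s a, fun _ h => h.2⟩ ⟨ht, h⟩

theorem timeFloor_le (hc : IsClosed T) (ha : IsLeast T a) (h : a ≤ s) : timeFloor T a s ≤ s :=
  (timeFloor_mem hc ha s).2.trans (max_le le_rfl h)

theorem timeFloor_monotone (hc : IsClosed T) (ha : IsLeast T a) : Monotone (timeFloor T a) :=
  fun s _ hsr => le_timeFloor (timeFloor_mem hc ha s).1
    ((timeFloor_mem hc ha s).2.trans (max_le_max_right a hsr))

/-- The floor is constant on each gap, so integrating `f ∘ timeFloor` across it contributes `μ(t)
f(t)`, as a delta integral should. -/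
theorem timeFloor_eq (hc : IsClosed T) (ha : IsLeast T a) (ht : t ∈ T) (h1 : t ≤ s)
    (h2 : s < forwardJump T t) : timeFloor T a s = t := by
  have has : a ≤ s := (ha.2 ht).trans h1
  refine le_antisymm ?_ (le_timeFloor ht (h1.trans (le_max_left _ _)))
  by_contra! hlt
  have := forwardJump_le (timeFloor_mem hc ha s).1 hlt
  linarith [timeFloor_le hc ha has]

variable {E : Type*} [NormedAddCommGroup E] {f : ℝ → E}

theorem intervalIntegrable_comp_timeFloor (hc : IsClosed T) (ha : IsLeast T a) (hf : Continuous f)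
    (x y : ℝ) : IntervalIntegrable (fun s => f (timeFloor T a s)) volume x y := by
  rw [intervalIntegrable_iff]
  obtain ⟨B, hB⟩ := (isCompact_Icc (a := a) (b := max (max x y) a)).exists_bound_of_continuousOn
    hf.continuousOn
  refine IntegrableOn.of_bound (by simp) ?_ B ?_
  · exact (hf.stronglyMeasurable.comp_measurable
      (timeFloor_monotone hc ha).measurable).aestronglyMeasurable
  · filter_upwards [ae_restrict_mem measurableSet_uIoc] with s hs
    refine hB _ ⟨ha.2 (timeFloor_mem hc ha s).1, (timeFloor_mem hc ha s).2.trans ?_⟩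
    exact max_le_max_right a hs.2

variable [NormedSpace ℝ E] [CompleteSpace E]

/-- A function given by integrating `f ∘ timeFloor` is a delta antiderivative of `f`. -/
theorem hasDeltaDerivAt_of_eq_integral (hc : IsClosed T) (hu : ¬ BddAbove T) (ha : IsLeast T a)
    (hf : Continuous f) {G : ℝ → E} {c : E}
    (hG : ∀ t ∈ T, G t = c + ∫ s in a..t, f (timeFloor T a s)) (ht : t ∈ T) :
    HasDeltaDerivAt T G (f t) t := by
  have hint := intervalIntegrable_comp_timeFloor hc ha hf
  intro ε hε
  obtain ⟨δ, hδ, hfδ⟩ := Metric.continuous_iff.1 hf t ε hε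
  set σ := forwardJump T t with hσ
  have htσ : t ≤ σ := le_forwardJump hu t
  have hσT : σ ∈ T := forwardJump_mem hc hu t
  -- The second bound excludes points of `T` in `(t, t + δ')` when `t` is right-scattered.
  obtain ⟨δ', hδ', hδδ, hjump⟩ : ∃ δ' > 0, δ' ≤ δ ∧ (t < σ → δ' ≤ σ - t) := by
    rcases eq_or_lt_of_le htσ with h | h
    · exact ⟨δ, hδ, le_rfl, fun h' => absurd h' (by rw [← h]; exact lt_irrefl _)⟩
    · exact ⟨min δ (σ - t), lt_min hδ (by linarith), min_le_left _ _, fun _ => min_le_right _ _⟩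
  refine ⟨δ', hδ', fun s hs hst => ?_⟩
  have e : G σ - G s - (σ - s) • f t = ∫ r in s..σ, (f (timeFloor T a r) - f t) := by
    rw [intervalIntegral.integral_sub (hint _ _) (by simp), intervalIntegral.integral_const,
      hG σ hσT, hG s hs, ← intervalIntegral.integral_interval_sub_left (hint a σ) (hint a s)]
    abel_nf
  rw [e]
  rw [abs_sub_comm σ s, abs_sub_comm s σ]
  refine intervalIntegral.norm_integral_le_of_norm_le_const_ae ?_
  -- The endpoint `σ` is discarded because the floor jumps there.
  filter_upwards [Set.Countable.ae_notMem (Set.countable_singleton σ) volume] with r hrσ hr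
  rw [Set.mem_singleton_iff] at hrσ
  rw [← dist_eq_norm]
  refine (hfδ _ ?_).le
  rw [Real.dist_eq]
  rw [abs_lt] at hst
  rcases le_or_gt s t with h | h
  · rw [Set.uIoc_of_le (h.trans htσ)] at hr
    have hrσ' : r < σ := lt_of_le_of_ne hr.2 hrσ
    rcases le_or_gt t r with h' | h'
    · rw [timeFloor_eq hc ha ht h' hrσ']
      simpa using hδ
    · have h1 := le_timeFloor hs (hr.1.le.trans (le_max_left r a))
      have h2 := timeFloor_le hc ha ((ha.2 hs).trans hr.1.le)
      rw [abs_lt]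
      constructor <;> linarith
  · have hσt : t = σ := by
      by_contra hne
      have hlt : t < σ := lt_of_le_of_ne htσ hne
      linarith [forwardJump_le hs h, hjump hlt]
    rw [Set.uIoc_of_ge (hσt ▸ h.le), ← hσt] at hr
    have h1 := le_timeFloor ht (hr.1.le.trans (le_max_left r a))
    have h2 := timeFloor_le hc ha ((ha.2 ht).trans hr.1.le)
    have := hr.2
    rw [abs_lt]
    constructor <;> linarith

end Floor

/-! ### The exponential series of a time scale. -/

/-- The monomials of the time scale `T` with least element `a`. -/
def timeMonomial (T : Set ℝ) (a : ℝ) : ℕ → ℝ → ℝ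
  | 0, _ => 1
  | k + 1, t => ∫ s in a..max t a, timeMonomial T a k (timeFloor T a s)

/-- The factor `‖1‖` keeps the zero ring, hence `n = 0`, within scope. -/
theorem norm_pow_le_norm_one_mul {R : Type*} [NormedRing R] (A : R) (k : ℕ) : ‖A ^ k‖ ≤ ‖(1 : R)‖ * ‖A‖ ^ k := by
  induction k with
  | zero => simp
  | succ k ih =>
    rw [pow_succ, pow_succ, ← mul_assoc]
    exact (norm_mul_le _ _).trans (by gcongr)

section Monomial

variable {T : Set ℝ} {a s t : ℝ}

theorem continuous_timeMonomial (hc : IsClosed T) (ha : IsLeast T a) (k : ℕ) :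
    Continuous (timeMonomial T a k) := by
  induction k with
  | zero => exact continuous_const
  | succ k ih =>
    exact (intervalIntegral.continuous_primitive (intervalIntegrable_comp_timeFloor hc ha ih) a).comp
      (by fun_prop : Continuous fun t : ℝ => max t a)

theorem timeMonomial_nonneg (k : ℕ) (t : ℝ) : 0 ≤ timeMonomial T a k t := by
  induction k generalizing t with
  | zero => exact zero_le_one
  | succ k ih => exact intervalIntegral.integral_nonneg (le_max_right _ _) fun s _ => ih _

/-- The floor of `s` is at most `s`, so each iterated integral is dominated by the one for the real
line. -/
theorem timeMonomial_le (hc : IsClosed T) (ha : IsLeast T a) (k : ℕ) (t : ℝ) :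
    timeMonomial T a k t ≤ (max t a - a) ^ k / (k.factorial : ℝ) := by
  induction k generalizing t with
  | zero => simp [timeMonomial]
  | succ k ih =>
    have hat : a ≤ max t a := le_max_right _ _
    calc timeMonomial T a (k + 1) t
        ≤ ∫ s in a..max t a, (s - a) ^ k / (k.factorial : ℝ) := by
          refine intervalIntegral.integral_mono_on hat
            (intervalIntegrable_comp_timeFloor hc ha (continuous_timeMonomial hc ha k) _ _)
            (Continuous.intervalIntegrable (by fun_prop) _ _) fun s hs => (ih _).trans ?_
          have h1 : max (timeFloor T a s) a ≤ s := max_le (timeFloor_le hc ha hs.1) hs.1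
          have h2 : a ≤ max (timeFloor T a s) a := le_max_right _ _
          gcongr
      _ = _ := by
          rw [intervalIntegral.integral_div, intervalIntegral.integral_comp_sub_right
            (fun x => x ^ k) a, integral_pow, Nat.factorial_succ]
          push_cast
          simp
          field_simp

variable {R : Type*} [NormedRing R] [NormedAlgebra ℝ R]

/-- The exponential `e_A(t, a) = ∑ h_k(t, a) A ^ k` of the time scale `T` with least element `a`. -/
def timeExp (T : Set ℝ) (a : ℝ) (A : R) (t : ℝ) : R := ∑' k, timeMonomial T a k t • A ^ k

theorem norm_timeMonomial_smul_le (hc : IsClosed T) (ha : IsLeast T a) (A : R) (k : ℕ) {b : ℝ}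
    (hab : a ≤ b) (htb : t ≤ b) : ‖timeMonomial T a k t • A ^ k‖ ≤
      ‖(1 : R)‖ * (((b - a) * ‖A‖) ^ k / (k.factorial : ℝ)) := by
  rw [norm_smul, Real.norm_of_nonneg (timeMonomial_nonneg _ _)]
  have h1 := timeMonomial_le hc ha k t
  have h2 : (max t a - a) ^ k / (k.factorial : ℝ) ≤ (b - a) ^ k / (k.factorial : ℝ) := by
    have : a ≤ max t a := le_max_right _ _
    have : max t a ≤ b := max_le htb hab
    gcongr
  calc _ ≤ ((b - a) ^ k / (k.factorial : ℝ)) * (‖(1 : R)‖ * ‖A‖ ^ k) := by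
        gcongr
        · exact h1.trans h2
        · exact norm_pow_le_norm_one_mul A k
    _ = _ := by rw [mul_pow]; ring

variable [CompleteSpace R]

theorem summable_timeExp (hc : IsClosed T) (ha : IsLeast T a) (A : R) (t : ℝ) :
    Summable fun k => timeMonomial T a k t • A ^ k :=
  Summable.of_norm_bounded ((Real.summable_pow_div_factorial _).mul_left _) fun k =>
    norm_timeMonomial_smul_le hc ha A k (le_max_right t a) (le_max_left t a)

theorem continuous_timeExp (hc : IsClosed T) (ha : IsLeast T a) (A : R) :
    Continuous (timeExp T a A) := by
  rw [continuous_iff_continuousAt]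
  intro t
  have : ContinuousOn (timeExp T a A) (Set.Iic (max (t + 1) a)) := by
    refine continuousOn_tsum (fun k => ?_) ((Real.summable_pow_div_factorial
      ((max (t + 1) a - a) * ‖A‖)).mul_left ‖(1 : R)‖) fun k s hs =>
        norm_timeMonomial_smul_le hc ha A k (le_max_right _ _) hs
    exact ((continuous_timeMonomial hc ha k).smul continuous_const).continuousOn
  exact this.continuousAt (Iic_mem_nhds ((lt_add_one t).trans_le (le_max_left _ _)))

theorem timeExp_eq_integral (hc : IsClosed T) (ha : IsLeast T a) (A : R) (hat : a ≤ t) :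
    timeExp T a A t = 1 + ∫ s in a..t, A * timeExp T a A (timeFloor T a s) := by
  have hs := intervalIntegral.hasSum_integral_of_dominated_convergence (μ := volume) (a := a)
    (b := t) (F := fun k s => timeMonomial T a k (timeFloor T a s) • A ^ (k + 1))
    (f := fun s => A * timeExp T a A (timeFloor T a s))
    (fun k _ => ‖A‖ * (‖(1 : R)‖ * (((t - a) * ‖A‖) ^ k / (k.factorial : ℝ)))) ?_ ?_ ?_ ?_ ?_
  · rw [timeExp, (summable_timeExp hc ha A t).tsum_eq_zero_add, ← hs.tsum_eq]
    congr 1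
    · simp [timeMonomial]
    · refine tsum_congr fun k => ?_
      rw [intervalIntegral.integral_smul_const, timeMonomial, max_eq_left hat]
  · intro k
    exact (((continuous_timeMonomial hc ha k).stronglyMeasurable.comp_measurable
      (timeFloor_monotone hc ha).measurable).smul_const _).aestronglyMeasurable
  · refine fun k => Eventually.of_forall fun s hs => ?_
    rw [Set.uIoc_of_le hat] at hs
    rw [pow_succ', ← mul_smul_comm]
    refine (norm_mul_le _ _).trans ?_
    gcongr
    exact norm_timeMonomial_smul_le hc ha A k hat ((timeFloor_le hc ha hs.1.le).trans hs.2)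
  · exact Eventually.of_forall fun s _ =>
      ((Real.summable_pow_div_factorial _).mul_left _).mul_left _
  · simp
  · refine Eventually.of_forall fun s _ => ?_
    have := (summable_timeExp hc ha A (timeFloor T a s)).hasSum.mul_left A
    simpa only [mul_smul_comm, ← pow_succ', timeExp] using this

theorem timeExp_hasDeltaDerivAt (hc : IsClosed T) (hu : ¬ BddAbove T) (ha : IsLeast T a) (A : R)
    (ht : t ∈ T) : HasDeltaDerivAt T (timeExp T a A) (A * timeExp T a A t) t :=
  hasDeltaDerivAt_of_eq_integral hc hu ha (f := fun t => A * timeExp T a A t)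
    (continuous_const.mul (continuous_timeExp hc ha A))
    (fun _ hs => timeExp_eq_integral hc ha A (ha.2 hs)) ht

theorem timeExp_self (hc : IsClosed T) (ha : IsLeast T a) (A : R) : timeExp T a A a = 1 := by
  rw [timeExp_eq_integral hc ha A le_rfl]
  simp

/-- A solution of `X^Δ = A X` is determined by its value at the least element of `T`. -/
theorem eq_timeExp_mul (hc : IsClosed T) (hu : ¬ BddAbove T) (ha : IsLeast T a) (A : R)
    {X : ℝ → R} (hX : ∀ t ∈ T, HasDeltaDerivAt T X (A * X t) t) (ht : t ∈ T) :
    X t = timeExp T a A t * X a := by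
  rw [← sub_eq_zero]
  refine eq_zero_of_hasDeltaDerivAt_of_norm_le (f := fun t => X t - timeExp T a A t * X a)
    (d := fun t => A * (X t - timeExp T a A t * X a)) hc hu ha (norm_nonneg A) (fun s hs => ?_)
    (fun s _ => norm_mul_le _ _) (by simp [timeExp_self hc ha]) t ht
  have := (hX s hs).sub ((timeExp_hasDeltaDerivAt hc hu ha A hs).clm_apply
    ((ContinuousLinearMap.mul ℝ R).flip (X a)))
  simpa [mul_sub, mul_assoc] using this

/-- Cocycle law, from uniqueness on the time scale truncated at `s`. -/
theorem timeExp_mul_timeExp (hc : IsClosed T) (hu : ¬ BddAbove T) (ha : IsLeast T a) (A : R)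
    (hs : s ∈ T) (ht : t ∈ T) (hst : s ≤ t) :
    timeExp T a A t = timeExp (T ∩ Set.Ici s) s A t * timeExp T a A s :=
  eq_timeExp_mul (hc.inter isClosed_Ici) (not_bddAbove_inter_Ici hu s)
    ⟨⟨hs, Set.self_mem_Ici⟩, fun _ h => h.2⟩ A
    (fun _ hr => (timeExp_hasDeltaDerivAt hc hu ha A hr.1).inter_Ici hr.2) ⟨ht, hst⟩

theorem isUnit_timeExp_of_lt (hc : IsClosed T) (ha : IsLeast T a) (A : R) {b : ℝ} (hab : a ≤ b)
    (hb : ‖(1 : R)‖ * (Real.exp ((b - a) * ‖A‖) - 1) < 1) : IsUnit (timeExp T a A b) := by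
  have h1 : ‖1 - timeExp T a A b‖ < 1 := by
    refine lt_of_le_of_lt ?_ hb
    rw [norm_sub_rev, timeExp, (summable_timeExp hc ha A b).tsum_eq_zero_add]
    simp only [timeMonomial, pow_zero, one_smul, add_sub_cancel_left]
    refine tsum_of_norm_bounded (HasSum.mul_left _ ?_) fun k =>
      norm_timeMonomial_smul_le hc ha A (k + 1) hab le_rfl
    have h := NormedSpace.expSeries_div_hasSum_exp ((b - a) * ‖A‖)
    rw [← Real.exp_eq_exp_ℝ] at h
    have := (hasSum_nat_add_iff' 1).2 h
    simpa using this
  have := isUnit_one_sub_of_norm_lt_one h1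
  rwa [sub_sub_cancel] at this

/-- Invertibility propagates along `T`: a jump multiplies by `1 + μ(t) A`, and a step shorter than
`η` by a factor close to `1`. That `η` is uniform in the base point settles left-dense points. -/
theorem isUnit_timeExp (hc : IsClosed T) (hu : ¬ BddAbove T) (ha : IsLeast T a) (A : R)
    (hA : ∀ t ∈ T, IsUnit (1 + graininess T t • A)) : ∀ t ∈ T, IsUnit (timeExp T a A t) := by
  obtain ⟨η, hη, hexp⟩ : ∃ η > 0, ∀ u, 0 ≤ u → u < η →
      ‖(1 : R)‖ * (Real.exp (u * ‖A‖) - 1) < 1 := by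
    have hcont : Continuous fun u : ℝ => ‖(1 : R)‖ * (Real.exp (u * ‖A‖) - 1) := by fun_prop
    have h0 := hcont.tendsto 0
    simp only [zero_mul, Real.exp_zero, sub_self, mul_zero] at h0
    obtain ⟨η, hη, h⟩ := Metric.eventually_nhds_iff.1 (h0.eventually (gt_mem_nhds one_pos))
    exact ⟨η, hη, fun u h1 h2 => h (by rwa [Real.dist_eq, sub_zero, abs_of_nonneg h1])⟩
  have step : ∀ s ∈ T, ∀ t ∈ T, s ≤ t → t - s < η → IsUnit (timeExp T a A s) →
      IsUnit (timeExp T a A t) := by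
    intro s hs t ht hst hts hP
    rw [timeExp_mul_timeExp hc hu ha A hs ht hst]
    exact (isUnit_timeExp_of_lt (hc.inter isClosed_Ici) ⟨⟨hs, Set.self_mem_Ici⟩, fun _ h => h.2⟩ A hst
      (hexp _ (sub_nonneg.2 hst) hts)).mul hP
  refine timeScale_induction hc hu ha ?_ ?_ ?_ ?_
  · rw [timeExp_self hc ha]; exact isUnit_one
  · intro t ht _ hP
    rw [(timeExp_hasDeltaDerivAt hc hu ha A ht).apply_forwardJump ht]
    have := (hA t ht).mul hP
    rwa [add_mul, one_mul, smul_mul_assoc] at this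
  · exact fun t ht _ hP => ⟨η, hη, fun s hs h1 h2 => step t ht s hs h1.le (by linarith) hP⟩
  · intro t ht hden hP
    obtain ⟨s, hs, h1, h2⟩ := hden η hη
    exact step s hs t ht h2.le (by linarith) (hP s hs h2)

/-- Existence of the transition matrix on all of `T` in the regressive case. -/
theorem exists_hasDeltaDerivAt_mul (hc : IsClosed T) (hu : ¬ BddAbove T) {t₀ : ℝ} (ht₀ : t₀ ∈ T)
    (A : R) (hA : ∀ t ∈ T, IsUnit (1 + graininess T t • A)) :
    ∃ X : ℝ → R, X t₀ = 1 ∧ ∀ t ∈ T, HasDeltaDerivAt T X (A * X t) t := by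
  have hc' : ∀ a, IsClosed (T ∩ Set.Ici a) := fun a => hc.inter isClosed_Ici
  have hu' := not_bddAbove_inter_Ici hu
  have hl : ∀ a ∈ T, IsLeast (T ∩ Set.Ici a) a := fun a ha => ⟨⟨ha, Set.self_mem_Ici⟩, fun _ h => h.2⟩
  have hunit : ∀ a ∈ T, ∀ t ∈ T, a ≤ t → IsUnit (timeExp (T ∩ Set.Ici a) a A t) := by
    intro a ha t ht hat
    refine isUnit_timeExp (hc' a) (hu' a) (hl a ha) A (fun s hs => ?_) t ⟨ht, hat⟩
    rw [graininess, forwardJump_inter_Ici hs.2]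
    exact hA s hs.1
  -- `Ψ a t` is `e_A(t, a) e_A(t₀, a)⁻¹`; by the cocycle law it does not depend on the base point `a
  -- ≤ t₀`, so these local solutions glue.
  set Ψ : ℝ → ℝ → R := fun a t =>
    timeExp (T ∩ Set.Ici a) a A t * Ring.inverse (timeExp (T ∩ Set.Ici a) a A t₀) with hΨ
  have hmin : ∀ t ∈ T, min t t₀ ∈ T := fun t ht => by
    rcases min_choice t t₀ with h | h <;> rw [h] <;> assumption
  have hindep : ∀ b ∈ T, ∀ a ∈ T, b ≤ a → a ≤ t₀ → ∀ t ∈ T, a ≤ t → Ψ b t = Ψ a t := by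
    intro b hb a ha hba hat₀ t ht hat
    have e : ∀ s ∈ T, a ≤ s → timeExp (T ∩ Set.Ici b) b A s =
        timeExp (T ∩ Set.Ici a) a A s * timeExp (T ∩ Set.Ici b) b A a := by
      intro s hs has
      have h := timeExp_mul_timeExp (hc' b) (hu' b) (hl b hb) A (s := a) (t := s) ⟨ha, hba⟩
        ⟨hs, hba.trans has⟩ has
      rwa [Set.inter_assoc, Set.inter_eq_self_of_subset_right (Set.Ici_subset_Ici.2 hba)] at h
    simp only [hΨ]
    obtain ⟨u, hu⟩ := hunit b hb a ha hba
    obtain ⟨v, hv⟩ := hunit a ha t₀ ht₀ hat₀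
    rw [e t ht hat, e t₀ ht₀ hat₀, ← hu, ← hv, ← Units.val_mul, Ring.inverse_unit,
      Ring.inverse_unit, mul_inv_rev, Units.val_mul, mul_assoc, Units.mul_inv_cancel_left]
  have hder : ∀ a ∈ T, ∀ t ∈ T, a ≤ t →
      HasDeltaDerivAt (T ∩ Set.Ici a) (Ψ a) (A * Ψ a t) t := by
    intro a ha t ht hat
    have := (timeExp_hasDeltaDerivAt (hc' a) (hu' a) (hl a ha) A ⟨ht, hat⟩).clm_apply
      ((ContinuousLinearMap.mul ℝ R).flip (Ring.inverse (timeExp (T ∩ Set.Ici a) a A t₀)))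
    simpa [hΨ, mul_assoc] using this
  refine ⟨fun t => Ψ (min t t₀) t, ?_, fun t ht => ?_⟩
  · simp [hΨ, timeExp_self (hc' t₀) (hl t₀ ht₀)]
  -- A base point strictly below `t` is wanted, so that points of `T` on both sides of `t` are
  -- covered; failing that, `min t t₀` is the least element.
  · obtain ⟨a, ha, hat, hat₀, hnear⟩ : ∃ a ∈ T, a ≤ t ∧ a ≤ t₀ ∧ (a < t ∨ IsLeast T a) := by
      by_cases h : ∃ a ∈ T, a < min t t₀
      · obtain ⟨a, ha, hlt⟩ := h
        exact ⟨a, ha, (hlt.trans_le (min_le_left _ _)).le, (hlt.trans_le (min_le_right _ _)).le,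
          Or.inl (hlt.trans_le (min_le_left _ _))⟩
      · push Not at h
        exact ⟨min t t₀, hmin t ht, min_le_left _ _, min_le_right _ _,
          Or.inr ⟨hmin t ht, fun s hs => h s hs⟩⟩
    have heq : ∀ s ∈ T, a ≤ s → Ψ (min s t₀) s = Ψ a s := fun s hs has =>
      (hindep a ha _ (hmin s hs) (le_min has hat₀) (min_le_right _ _) s hs (min_le_left _ _)).symm
    show HasDeltaDerivAt T (fun t => Ψ (min t t₀) t) (A * Ψ (min t t₀) t) t
    rw [heq t ht hat]
    exact (hder a ha t ht hat).of_inter_Ici hc hu hat hnear heq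

end Monomial

end

/-! ### Outputs of solutions and powers of `A`. -/

section Output

variable {T : Set ℝ} {t : ℝ}

theorem HasDeltaDerivAt.eq_zero_of_forall_Icc {E : Type*} [NormedAddCommGroup E]
    [NormedSpace ℝ E] {g : ℝ → E} {g' : E} {r : ℝ} (hu : ¬ BddAbove T)
    (h : HasDeltaDerivAt T g g' t) (ht : t ∈ T) (hr : r ∈ T) (htr : t < r)
    (hg : ∀ s ∈ T, t ≤ s → s ≤ r → g s = 0) (hc : IsClosed T) : g' = 0 := by
  rcases eq_or_lt_of_le (le_forwardJump hu t) with hj | hj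
  · rw [← norm_le_zero_iff]
    refine le_of_forall_pos_le_add fun ε hε => ?_
    obtain ⟨δ, hδ, hd⟩ := h ε hε
    obtain ⟨s, hs, h1, h2⟩ := exists_mem_Ioo_of_forwardJump_eq hu hj.symm
      (lt_min (lt_add_of_pos_right t hδ) htr)
    have h3 := h2.trans_le (min_le_left _ _)
    have h4 := h2.trans_le (min_le_right _ _)
    have := hd s hs (by rw [abs_of_pos (by linarith)]; linarith)
    rw [← hj, hg t ht le_rfl htr.le, hg s hs h1.le h4.le, sub_zero, zero_sub, norm_neg, norm_smul,
      Real.norm_eq_abs, mul_comm] at this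
    rw [zero_add]
    exact le_of_mul_le_mul_right this (abs_pos.2 (by linarith))
  · have := h.apply_forwardJump ht
    rw [hg t ht le_rfl htr.le, hg _ (forwardJump_mem hc hu t) hj.le (forwardJump_le hr htr),
      zero_add] at this
    exact (smul_eq_zero.1 this.symm).resolve_left (sub_pos.2 hj).ne'

variable {n p : ℕ} {A : Matrix (Fin n) (Fin n) ℝ} {x : ℝ → Fin n → ℝ}

theorem IsSolution.hasDeltaDerivAt_mulVec {m : ℕ} (hx : IsSolution T A x)
    (C : Matrix (Fin m) (Fin n) ℝ) (ht : t ∈ T) :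
    HasDeltaDerivAt T (fun s => C.mulVec (x s)) ((C * A).mulVec (x t)) t := by
  have := (hx t ht).clm_apply (LinearMap.toContinuousLinearMap C.mulVecLin)
  simpa using this

/-- Each differentiation shrinks the interval of vanishing, but right-density always leaves a
nondegenerate one. -/
theorem IsSolution.output_eq_zero_of_dense (hc : IsClosed T) (hu : ¬ BddAbove T)
    (hx : IsSolution T A x) (C : Matrix (Fin p) (Fin n) ℝ) (hj : forwardJump T t = t)
    {tf : ℝ} (htf : t < tf) (h0 : ∀ s ∈ T ∩ Set.Ico t tf, C.mulVec (x s) = 0) (k : ℕ) :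
    ∃ r ∈ T, t < r ∧ ∀ s ∈ T, t ≤ s → s ≤ r → (C * A ^ k).mulVec (x s) = 0 := by
  induction k with
  | zero =>
    obtain ⟨r, hr, h1, h2⟩ := exists_mem_Ioo_of_forwardJump_eq hu hj htf
    refine ⟨r, hr, h1, fun s hs h3 h4 => ?_⟩
    rw [pow_zero, Matrix.mul_one]
    exact h0 s ⟨hs, h3, h4.trans_lt h2⟩
  | succ k ih =>
    obtain ⟨r, hr, htr, h⟩ := ih
    obtain ⟨q, hq, h1, h2⟩ := exists_mem_Ioo_of_forwardJump_eq hu hj htr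
    refine ⟨q, hq, h1, fun s hs h3 h4 => ?_⟩
    have := (hx.hasDeltaDerivAt_mulVec (C * A ^ k) hs).eq_zero_of_forall_Icc hu hs hr
      (h4.trans_lt h2) (fun u hu h5 h6 => h u hu (h3.trans h5) h6) hc
    rwa [pow_succ, ← Matrix.mul_assoc]

/-- Induction on the number of samples: at a right-scattered `t`, vanishing of `m` powers at `σ(t)`
and of the output at `t` yields `m + 1` powers at `t`, on dividing by `μ(t)`. -/
theorem IsSolution.mulVec_pow_eq_zero_of_output_eq_zero (hc : IsClosed T) (hu : ¬ BddAbove T)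
    (hx : IsSolution T A x) (C : Matrix (Fin p) (Fin n) ℝ) {tf : ℝ} (m : ℕ) (ht : t ∈ T)
    (hm : (m : ℕ∞) ≤ (T ∩ Set.Ico t tf).encard)
    (h0 : ∀ s ∈ T ∩ Set.Ico t tf, C.mulVec (x s) = 0) (k : ℕ) (hk : k < m) :
    (C * A ^ k).mulVec (x t) = 0 := by
  induction m generalizing t k with
  | zero => exact absurd hk (Nat.not_lt_zero k)
  | succ m ih =>
    have htf : t < tf := by
      have hne : (T ∩ Set.Ico t tf).Nonempty := by
        rw [← Set.encard_pos]
        exact lt_of_lt_of_le (by simp) hm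
      obtain ⟨s, _, hs⟩ := hne
      exact hs.1.trans_lt hs.2
    rcases eq_or_lt_of_le (le_forwardJump hu t) with hj | hj
    · obtain ⟨r, _, htr, h⟩ := hx.output_eq_zero_of_dense hc hu C hj.symm htf h0 k
      exact h t ht le_rfl htr.le
    · have hsub : T ∩ Set.Ico t tf ⊆ insert t (T ∩ Set.Ico (forwardJump T t) tf) := by
        rintro s ⟨hs, h1, h2⟩
        rcases eq_or_lt_of_le h1 with h | h
        · exact Or.inl h.symm
        · exact Or.inr ⟨hs, forwardJump_le hs h, h2⟩
      have hm' : (m : ℕ∞) ≤ (T ∩ Set.Ico (forwardJump T t) tf).encard := by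
        have h1 := (hm.trans (Set.encard_le_encard hsub)).trans (Set.encard_insert_le _ _)
        rw [Nat.cast_succ] at h1
        exact (ENat.add_le_add_iff_right ENat.one_ne_top).1 h1
      have hσ := ih (forwardJump_mem hc hu t) hm'
        fun s hs => h0 s ⟨hs.1, hj.le.trans hs.2.1, hs.2.2⟩
      induction k with
      | zero =>
        rw [pow_zero, Matrix.mul_one]
        exact h0 t ⟨ht, le_rfl, htf⟩
      | succ k ihk =>
        have h1 := (hx.hasDeltaDerivAt_mulVec (C * A ^ k) ht).apply_forwardJump ht
        rw [hσ k (by omega), ihk (by omega), zero_add, Matrix.mul_assoc, ← pow_succ] at h1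
        exact (smul_eq_zero.1 h1.symm).resolve_left (sub_pos.2 hj).ne'

open Matrix in
theorem rank_observabilityMatrix_eq_iff (A : Matrix (Fin n) (Fin n) ℝ)
    (C : Matrix (Fin p) (Fin n) ℝ) : (observabilityMatrix A C).rank = n ↔
      ∀ v : Fin n → ℝ, (∀ k < n, (C * A ^ k).mulVec v = 0) → v = 0 := by
  have hker : ∀ v, (observabilityMatrix A C).mulVec v = 0 ↔ ∀ k < n, (C * A ^ k).mulVec v = 0 := by
    intro v
    constructor
    · intro h k hk
      ext i
      exact congrFun h (⟨k, hk⟩, i)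
    · intro h
      ext ⟨k, i⟩
      exact congrFun (h k k.2) i
  simp only [← hker]
  have hrn := LinearMap.finrank_range_add_finrank_ker (observabilityMatrix A C).mulVecLin
  rw [Module.finrank_fin_fun] at hrn
  change (observabilityMatrix A C).rank + _ = n at hrn
  have e : (observabilityMatrix A C).rank = n ↔
      Module.finrank ℝ (LinearMap.ker (observabilityMatrix A C).mulVecLin) = 0 := by omega
  rw [e, Submodule.finrank_eq_zero, LinearMap.ker_eq_bot']
  rfl

/-- By Cayley–Hamilton, the kernel of the observability matrix is annihilated by all `C A ^ k`. -/
theorem mulVec_pow_eq_zero_of_lt (C : Matrix (Fin p) (Fin n) ℝ) {v : Fin n → ℝ}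
    (h : ∀ k < n, (C * A ^ k).mulVec v = 0) (k : ℕ) : (C * A ^ k).mulVec v = 0 := by
  rw [A.pow_eq_aeval_mod_charpoly k, Polynomial.aeval_eq_sum_range, Matrix.mul_sum,
    Matrix.sum_mulVec]
  refine Finset.sum_eq_zero fun i hi => ?_
  rw [Matrix.mul_smul, Matrix.smul_mulVec]
  rcases lt_or_ge i n with hin | hin
  · rw [h i hin, smul_zero]
  -- The remainder of `X ^ k` modulo the characteristic polynomial has degree below `n`.
  · rw [Polynomial.coeff_eq_zero_of_degree_lt, zero_smul]
    refine (Polynomial.degree_modByMonic_lt _ A.charpoly_monic).trans_le ?_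
    rw [A.charpoly_degree_eq_dim]
    simpa using hin

section Operator

attribute [local instance] Matrix.linftyOpNormedRing Matrix.linftyOpNormedAlgebra

theorem exists_isTransitionMatrix (hc : IsClosed T) (hu : ¬ BddAbove T) {t₀ : ℝ} (ht₀ : t₀ ∈ T)
    (hA : IsRegressive T A) : ∃ Φ, IsTransitionMatrix T A t₀ Φ := by
  have : CompleteSpace (Matrix (Fin n) (Fin n) ℝ) := FiniteDimensional.complete ℝ _
  obtain ⟨X, h0, hX⟩ := exists_hasDeltaDerivAt_mul hc hu ht₀ A hA
  exact ⟨X, h0, fun t ht i j =>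
    (hX t ht).clm_apply (LinearMap.toContinuousLinearMap (Matrix.entryLinearMap ℝ ℝ i j))⟩

/-- By uniqueness `x` is the exponential series applied to `x t₀`, and `C` kills it term by term. -/
theorem IsSolution.output_eq_zero (hc : IsClosed T) (hu : ¬ BddAbove T) {t₀ : ℝ} (ht₀ : t₀ ∈ T)
    (hx : IsSolution T A x) (C : Matrix (Fin p) (Fin n) ℝ)
    (h0 : ∀ k, (C * A ^ k).mulVec (x t₀) = 0) (ht : t ∈ T) (htt : t₀ ≤ t) :
    C.mulVec (x t) = 0 := by
  have : CompleteSpace (Matrix (Fin n) (Fin n) ℝ) := FiniteDimensional.complete ℝ _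
  have hc' : IsClosed (T ∩ Set.Ici t₀) := hc.inter isClosed_Ici
  have hl : IsLeast (T ∩ Set.Ici t₀) t₀ := ⟨⟨ht₀, Set.self_mem_Ici⟩, fun _ h => h.2⟩
  have hu' := not_bddAbove_inter_Ici hu t₀
  set e := timeExp (T ∩ Set.Ici t₀) t₀ A with he
  let L : Matrix (Fin n) (Fin n) ℝ →L[ℝ] (Fin n → ℝ) :=
    LinearMap.toContinuousLinearMap ((Matrix.mulVecBilin ℝ ℝ).flip (x t₀))
  have hL : ∀ M, L M = M.mulVec (x t₀) := fun M => rfl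
  have hxe : x t = L (e t) := by
    rw [← sub_eq_zero]
    refine eq_zero_of_hasDeltaDerivAt_of_norm_le (f := fun t => x t - L (e t))
      (d := fun t => A.mulVec (x t - L (e t))) hc' hu' hl (norm_nonneg A) (fun s hs => ?_)
      (fun s _ => Matrix.linfty_opNorm_mulVec _ _) ?_ t ⟨ht, htt⟩
    · have := ((hx s hs.1).inter_Ici hs.2).sub
        ((timeExp_hasDeltaDerivAt hc' hu' hl A hs).clm_apply L)
      have e1 : A.mulVec (x s - L (e s)) = A.mulVec (x s) - L (A * e s) := by
        rw [Matrix.mulVec_sub, hL, hL, Matrix.mulVec_mulVec]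
      rw [e1]
      exact this
    · simp [he, hL, timeExp_self hc' hl]
  rw [hxe]
  have hs := (LinearMap.toContinuousLinearMap C.mulVecLin).hasSum
    (L.hasSum (summable_timeExp hc' hl A t).hasSum)
  refine hs.unique (hasSum_zero.congr_fun fun k => ?_)
  change C.mulVec ((timeMonomial (T ∩ Set.Ici t₀) t₀ k t • A ^ k).mulVec (x t₀)) = 0
  rw [Matrix.smul_mulVec, Matrix.mulVec_smul, Matrix.mulVec_mulVec, h0 k, smul_zero]

end Operator

theorem IsTransitionMatrix.isSolution {t₀ : ℝ} {Φ : ℝ → Matrix (Fin n) (Fin n) ℝ}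
    (h : IsTransitionMatrix T A t₀ Φ) (v : Fin n → ℝ) :
    IsSolution T A fun t => (Φ t).mulVec v := by
  intro t ht
  -- Matrices are read as iterated functions, whose sup norm matches the entrywise derivatives.
  have h1 : HasDeltaDerivAt T (E := Fin n → Fin n → ℝ) Φ (A * Φ t) t :=
    hasDeltaDerivAt_pi fun i => hasDeltaDerivAt_pi fun j => h.2 t ht i j
  let L : (Fin n → Fin n → ℝ) →ₗ[ℝ] (Fin n → ℝ) :=
    { toFun := fun M => Matrix.mulVec M v
      map_add' := fun M N => Matrix.add_mulVec M N v
      map_smul' := fun c M => Matrix.smul_mulVec c M v }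
  have := h1.clm_apply (LinearMap.toContinuousLinearMap L)
  rw [Matrix.mulVec_mulVec]
  exact this

end Output

/-! ### Finiteness and positivity of the delta measure. -/

section DeltaMeasure

variable {T : Set ℝ} {t₀ tf : ℝ}

/-- The atom at `t` weighs as much as the gap `[t, σ(t))`; these gaps are disjoint and, as `tf ∈ T`,
those starting in `[t₀, tf)` stay inside it. -/
theorem deltaMeasure_inter_Ico_lt_top (hc : IsClosed T) (htf : tf ∈ T) :
    deltaMeasure T (T ∩ Set.Ico t₀ tf) < ⊤ := by
  have hS : MeasurableSet (T ∩ Set.Ico t₀ tf) := hc.measurableSet.inter measurableSet_Ico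
  rw [deltaMeasure, Measure.add_apply, ENNReal.add_lt_top]
  constructor
  · refine (measure_mono Set.inter_subset_right).trans_lt ?_
    exact (Measure.restrict_apply_le _ _).trans_lt measure_Ico_lt_top
  rw [Measure.sum_apply _ hS]
  set As : {t : ℝ // t ∈ T ∧ t < forwardJump T t} → Set ℝ :=
    fun t => Set.Ico (t : ℝ) (forwardJump T t) ∩ Set.Ico t₀ tf with hAs
  calc _ ≤ ∑' t, volume (As t) := by
        refine ENNReal.tsum_le_tsum fun t => ?_
        rw [Measure.smul_apply, Measure.dirac_apply' _ hS, smul_eq_mul]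
        by_cases ht : (t : ℝ) ∈ T ∩ Set.Ico t₀ tf
        · rw [Set.indicator_of_mem ht, Pi.one_apply, mul_one]
          have : As t = Set.Ico (t : ℝ) (forwardJump T t) :=
            Set.inter_eq_left.2 (Set.Ico_subset_Ico ht.2.1 (forwardJump_le htf ht.2.2))
          rw [this, Real.volume_Ico, graininess]
        · rw [Set.indicator_of_notMem ht, mul_zero]
          exact zero_le
    _ ≤ volume (⋃ t, As t) := by
        refine tsum_meas_le_meas_iUnion_of_disjoint _
          (fun t => measurableSet_Ico.inter measurableSet_Ico) ?_
        intro s t hst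
        refine Set.disjoint_left.2 fun r hrs hrt => ?_
        have hne : (s : ℝ) ≠ t := fun h => hst (Subtype.ext h)
        rcases lt_or_gt_of_ne hne with h | h
        · exact absurd (forwardJump_le t.2.1 h) (not_le.2 (hrt.1.1.trans_lt hrs.1.2))
        · exact absurd (forwardJump_le s.2.1 h) (not_le.2 (hrs.1.1.trans_lt hrt.1.2))
    _ ≤ volume (Set.Ico t₀ tf) := measure_mono (Set.iUnion_subset fun t => Set.inter_subset_right)
    _ < ⊤ := measure_Ico_lt_top

theorem integrableOn_deltaMeasure (hc : IsClosed T) (htf : tf ∈ T) {g : ℝ → ℝ}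
    (hg : ContinuousOn g T) : IntegrableOn g (T ∩ Set.Ico t₀ tf) (deltaMeasure T) := by
  have hS : MeasurableSet (T ∩ Set.Ico t₀ tf) := hc.measurableSet.inter measurableSet_Ico
  obtain ⟨B, hB⟩ := (isCompact_Icc (a := t₀) (b := tf)).inter_left hc
    |>.exists_bound_of_continuousOn (hg.mono Set.inter_subset_left)
  refine IntegrableOn.of_bound (deltaMeasure_inter_Ico_lt_top hc htf)
    ((hg.mono Set.inter_subset_left).aestronglyMeasurable hS) B ?_
  filter_upwards [ae_restrict_mem hS] with t ht using hB t ⟨ht.1, Set.Ico_subset_Icc_self ht.2⟩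

theorem deltaMeasure_pos_of_mem {t : ℝ} (ht : t ∈ T) (htσ : t < forwardJump T t) {S : Set ℝ}
    (hS : t ∈ S) : 0 < deltaMeasure T S := by
  have h1 : Measure.sum (fun t : {t : ℝ // t ∈ T ∧ t < forwardJump T t} =>
      ENNReal.ofReal (graininess T t) • Measure.dirac (t : ℝ)) S ≤ deltaMeasure T S :=
    Measure.le_add_left le_rfl S
  refine lt_of_lt_of_le ?_ ((Measure.le_sum (fun t : {t : ℝ // t ∈ T ∧ t < forwardJump T t} =>
      ENNReal.ofReal (graininess T t) • Measure.dirac (t : ℝ)) ⟨t, ht, htσ⟩ S).trans h1)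
  rw [Measure.smul_apply, Measure.dirac_apply_of_mem hS, smul_eq_mul, mul_one]
  exact ENNReal.ofReal_pos.2 (sub_pos.2 htσ)

/-- Left-closed intervals of a time scale that start at a point of it have positive measure. -/
theorem deltaMeasure_inter_Ico_pos (hc : IsClosed T) {t r : ℝ} (ht : t ∈ T) (hr : r ∈ T)
    (htr : t < r) : 0 < deltaMeasure T (T ∩ Set.Ico t r) := by
  by_cases hsc : ∃ s ∈ T ∩ Set.Ico t r, s < forwardJump T s
  · obtain ⟨s, hs, h⟩ := hsc
    exact deltaMeasure_pos_of_mem hs.1 h hs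
  push Not at hsc
  -- A missing point `u` would make the last point of `T` before `u` right-scattered.
  have hsub : Set.Ico t r ⊆ T := by
    intro u hu
    by_contra huT
    have hbd : BddAbove (T ∩ Set.Iic u) := ⟨u, fun _ h => h.2⟩
    have hs := (hc.inter isClosed_Iic).csSup_mem ⟨t, ht, hu.1⟩ hbd
    set s := sSup (T ∩ Set.Iic u) with hsdef
    have hts : t ≤ s := le_csSup hbd ⟨ht, hu.1⟩
    have hsu : s < u := lt_of_le_of_ne hs.2 fun h => huT (h ▸ hs.1)
    refine absurd (hsc s ⟨hs.1, hts, hsu.trans hu.2⟩) (not_le.2 (hsu.trans_le ?_))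
    refine le_csInf ⟨r, hr, hsu.trans hu.2⟩ fun q hq => ?_
    by_contra! hqu
    exact absurd (le_csSup hbd ⟨hq.1, hqu.le⟩) (not_le.2 hq.2)
  rw [Set.inter_eq_right.2 hsub]
  have h1 : volume.restrict T (Set.Ico t r) ≤ deltaMeasure T (Set.Ico t r) :=
    Measure.le_add_right le_rfl _
  refine lt_of_lt_of_le ?_ h1
  rw [Measure.restrict_apply measurableSet_Ico, Set.inter_eq_left.2 hsub, Real.volume_Ico]
  exact ENNReal.ofReal_pos.2 (sub_pos.2 htr)

theorem eq_zero_of_ae_eq_zero_deltaMeasure (hc : IsClosed T) (hu : ¬ BddAbove T) {g : ℝ → ℝ}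
    (hg : ContinuousOn g T)
    (h : ∀ᵐ t ∂(deltaMeasure T).restrict (T ∩ Set.Ico t₀ tf), g t = 0) :
    ∀ t ∈ T ∩ Set.Ico t₀ tf, g t = 0 := by
  intro t ht
  by_contra hne
  rw [ae_restrict_iff' (hc.measurableSet.inter measurableSet_Ico), ae_iff] at h
  rcases eq_or_lt_of_le (le_forwardJump hu t) with hj | hj
  · have hev := (hg t ht.1).eventually_ne hne
    rw [eventually_nhdsWithin_iff, Metric.eventually_nhds_iff] at hev
    obtain ⟨δ, hδ, hev⟩ := hev
    obtain ⟨r, hr, h1, h2⟩ := exists_mem_Ioo_of_forwardJump_eq hu hj.symm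
      (lt_min (lt_add_of_pos_right t hδ) ht.2.2)
    refine (deltaMeasure_inter_Ico_pos hc ht.1 hr h1).ne' (measure_mono_null ?_ h)
    rintro s ⟨hs, hts, hsr⟩
    have h3 := h2.trans_le (min_le_left _ _)
    have h4 := h2.trans_le (min_le_right _ _)
    rw [Set.mem_ofPred_eq, Classical.not_imp]
    refine ⟨⟨hs, ht.2.1.trans hts, hsr.trans h4⟩, hev ?_ hs⟩
    rw [Real.dist_eq, abs_of_nonneg (by linarith)]
    linarith
  · exact (deltaMeasure_pos_of_mem ht.1 hj
      (S := {t | ¬(t ∈ T ∩ Set.Ico t₀ tf → g t = 0)}) (fun h' => hne (h' ht))).ne' h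

end DeltaMeasure

/-! ### The Gramian as a quadratic form. -/

section Gramian

variable {n p : ℕ} {T : Set ℝ} {t₀ tf : ℝ} {A : Matrix (Fin n) (Fin n) ℝ}
  {Φ : ℝ → Matrix (Fin n) (Fin n) ℝ}

theorem IsTransitionMatrix.continuousOn (h : IsTransitionMatrix T A t₀ Φ) : ContinuousOn Φ T :=
  continuousOn_pi.2 fun i => continuousOn_pi.2 fun j => fun t ht =>
    (h.2 t ht i j).continuousWithinAt ht

theorem observabilityGramian_mulVec (hc : IsClosed T) (htf : tf ∈ T)
    (C : Matrix (Fin p) (Fin n) ℝ) (hΦ : ContinuousOn Φ T) (v : Fin n → ℝ) (i : Fin n) :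
    (observabilityGramian T C Φ t₀ tf).mulVec v i = ∫ t in T ∩ Set.Ico t₀ tf,
      ((Φ t).transpose.mulVec (C.transpose.mulVec (C.mulVec ((Φ t).mulVec v)))) i
        ∂(deltaMeasure T) := by
  have hcont : ∀ j, Continuous fun X : Matrix (Fin n) (Fin n) ℝ =>
      (X.transpose * C.transpose * C * X) i j * v j := fun j => by fun_prop
  have hint : ∀ j, IntegrableOn (fun t => ((Φ t).transpose * C.transpose * C * Φ t) i j * v j)
      (T ∩ Set.Ico t₀ tf) (deltaMeasure T) := fun j =>
    integrableOn_deltaMeasure hc htf ((hcont j).comp_continuousOn hΦ)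
  simp only [Matrix.mulVec_mulVec, ← Matrix.mul_assoc]
  simp only [Matrix.mulVec, dotProduct, observabilityGramian, Matrix.of_apply]
  rw [integral_finsetSum _ fun j _ => hint j]
  exact Finset.sum_congr rfl fun j _ => (integral_mul_const _ _).symm

theorem dotProduct_observabilityGramian_mulVec (hc : IsClosed T) (htf : tf ∈ T)
    (C : Matrix (Fin p) (Fin n) ℝ) (hΦ : ContinuousOn Φ T) (v : Fin n → ℝ) :
    v ⬝ᵥ (observabilityGramian T C Φ t₀ tf).mulVec v = ∫ t in T ∩ Set.Ico t₀ tf,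
      C.mulVec ((Φ t).mulVec v) ⬝ᵥ C.mulVec ((Φ t).mulVec v) ∂(deltaMeasure T) := by
  have hcont : ∀ i, Continuous fun X : Matrix (Fin n) (Fin n) ℝ => v i *
      (X.transpose.mulVec (C.transpose.mulVec (C.mulVec (X.mulVec v)))) i := fun j => by fun_prop
  have hint : ∀ i, IntegrableOn (fun t => v i * ((Φ t).transpose.mulVec
      (C.transpose.mulVec (C.mulVec ((Φ t).mulVec v)))) i) (T ∩ Set.Ico t₀ tf) (deltaMeasure T) :=
    fun i => integrableOn_deltaMeasure hc htf ((hcont i).comp_continuousOn hΦ)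
  rw [dotProduct]
  simp only [observabilityGramian_mulVec hc htf C hΦ, ← integral_const_mul]
  rw [← integral_finsetSum _ fun i _ => hint i]
  refine integral_congr_ae (Eventually.of_forall fun t => ?_)
  change v ⬝ᵥ (Φ t).transpose.mulVec _ = _
  rw [Matrix.dotProduct_mulVec, Matrix.vecMul_transpose, Matrix.dotProduct_mulVec,
    Matrix.vecMul_transpose]

/-- The kernel of the Gramian consists of the initial states with zero output. -/
theorem observabilityGramian_mulVec_eq_zero_iff (hc : IsClosed T) (hu : ¬ BddAbove T)
    (htf : tf ∈ T) (C : Matrix (Fin p) (Fin n) ℝ) (hΦ : ContinuousOn Φ T) (v : Fin n → ℝ) :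
    (observabilityGramian T C Φ t₀ tf).mulVec v = 0 ↔
      ∀ t ∈ T ∩ Set.Ico t₀ tf, C.mulVec ((Φ t).mulVec v) = 0 := by
  constructor
  · intro h t ht
    have h0 := dotProduct_observabilityGramian_mulVec (t₀ := t₀) hc htf C hΦ v
    rw [h, dotProduct_zero] at h0
    have hcont : Continuous fun X : Matrix (Fin n) (Fin n) ℝ =>
      C.mulVec (X.mulVec v) ⬝ᵥ C.mulVec (X.mulVec v) := by fun_prop
    have hco := hcont.comp_continuousOn hΦ
    have hnn : ∀ w : Fin p → ℝ, 0 ≤ w ⬝ᵥ w := fun w =>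
      Finset.sum_nonneg fun i _ => mul_self_nonneg (w i)
    have hae := (integral_eq_zero_iff_of_nonneg (fun t => hnn (C.mulVec ((Φ t).mulVec v)))
      (integrableOn_deltaMeasure (t₀ := t₀) hc htf hco)).1 h0.symm
    exact dotProduct_self_eq_zero.1 (eq_zero_of_ae_eq_zero_deltaMeasure hc hu hco hae t ht)
  · intro h
    ext i
    rw [observabilityGramian_mulVec hc htf C hΦ, Pi.zero_apply]
    refine setIntegral_eq_zero_of_forall_eq_zero fun t ht => ?_
    rw [h t ht]
    simp

end Gramian

theorem isUnit_iff_forall_mulVec_eq_zero {n : ℕ} (M : Matrix (Fin n) (Fin n) ℝ) :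
    IsUnit M ↔ ∀ v, M.mulVec v = 0 → v = 0 := by
  rw [← Matrix.mulVec_injective_iff_isUnit]
  exact injective_iff_map_eq_zero M.mulVecLin

theorem theorem3p5 {n p : ℕ} (T : Set ℝ) (hT : IsUnboundedTimeScale T)
    (A : Matrix (Fin n) (Fin n) ℝ) (C : Matrix (Fin p) (Fin n) ℝ) (hA : IsRegressive T A)
    (t₀ tf : ℝ) (ht₀ : t₀ ∈ T) (htf : tf ∈ T) (hlt : t₀ < tf) :
    (IsObservable T A C t₀ tf → (observabilityMatrix A C).rank = n) ∧
    ((n : ℕ∞) ≤ (T ∩ Set.Ico t₀ tf).encard →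
      (IsObservable T A C t₀ tf ↔ (observabilityMatrix A C).rank = n)) ∧
    (∃ Φ : ℝ → Matrix (Fin n) (Fin n) ℝ, IsTransitionMatrix T A t₀ Φ) ∧
    (∀ Φ : ℝ → Matrix (Fin n) (Fin n) ℝ, IsTransitionMatrix T A t₀ Φ →
      (IsUnit (observabilityGramian T C Φ t₀ tf) → (observabilityMatrix A C).rank = n) ∧
      ((n : ℕ∞) ≤ (T ∩ Set.Ico t₀ tf).encard →
        ((observabilityMatrix A C).rank = n ↔ IsUnit (observabilityGramian T C Φ t₀ tf)))) := by
  have hc := hT.isClosed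
  have hu := hT.not_bddAbove
  have hex := exists_isTransitionMatrix hc hu ht₀ hA
  have hzero : ∀ x, IsSolution T A x → (∀ k < n, (C * A ^ k).mulVec (x t₀) = 0) →
      ∀ t ∈ T ∩ Set.Ico t₀ tf, C.mulVec (x t) = 0 := fun x hx h t ht =>
    hx.output_eq_zero hc hu ht₀ C (mulVec_pow_eq_zero_of_lt C h) ht.1 ht.2.1
  have hobs : IsObservable T A C t₀ tf → (observabilityMatrix A C).rank = n := by
    intro h
    rw [rank_observabilityMatrix_eq_iff]
    intro v hv
    obtain ⟨Φ, hΦ⟩ := hex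
    have hv₀ : (Φ t₀).mulVec v = v := by rw [hΦ.1, Matrix.one_mulVec]
    -- The solution through `v` has the same zero output as the trivial solution.
    have h0 : (Φ t₀).mulVec v = (Φ t₀).mulVec 0 := by
      refine h _ _ (hΦ.isSolution v) (hΦ.isSolution 0) fun t ht => ?_
      rw [hzero _ (hΦ.isSolution v) (fun k hk => by rw [hv₀, hv k hk]) t ht]
      simp
    rwa [hv₀, Matrix.mulVec_zero] at h0
  refine ⟨hobs, fun hn => ⟨hobs, fun hrank x₁ x₂ h₁ h₂ hy => ?_⟩, hex, fun Φ hΦ => ?_⟩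
  · rw [rank_observabilityMatrix_eq_iff] at hrank
    have hsub : IsSolution T A fun t => x₁ t - x₂ t := fun t ht => by
      rw [Matrix.mulVec_sub]
      exact (h₁ t ht).sub (h₂ t ht)
    rw [← sub_eq_zero]
    refine hrank _ (hsub.mulVec_pow_eq_zero_of_output_eq_zero hc hu C n ht₀ hn fun t ht => ?_)
    rw [Matrix.mulVec_sub, hy t ht, sub_self]
  · have hv₀ : ∀ v, (Φ t₀).mulVec v = v := fun v => by rw [hΦ.1, Matrix.one_mulVec]
    have hker := observabilityGramian_mulVec_eq_zero_iff (t₀ := t₀) hc hu htf C hΦ.continuousOn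
    -- Both conditions now say that a kernel is trivial, so inclusions between the kernels suffice.
    simp only [rank_observabilityMatrix_eq_iff, isUnit_iff_forall_mulVec_eq_zero, hker]
    have hgram : (∀ v, (∀ t ∈ T ∩ Set.Ico t₀ tf, C.mulVec ((Φ t).mulVec v) = 0) → v = 0) →
        ∀ v, (∀ k < n, (C * A ^ k).mulVec v = 0) → v = 0 := fun h v hv =>
      h v (hzero _ (hΦ.isSolution v) fun k hk => by rw [hv₀, hv k hk])
    refine ⟨hgram, fun hn => ⟨fun h v hv => h v fun k hk => ?_, hgram⟩⟩
    have := (hΦ.isSolution v).mulVec_pow_eq_zero_of_output_eq_zero hc hu C n ht₀ hn hv k hk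
    rwa [hv₀] at this
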